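/- All topological groups are Hausdorff. A group $\Gamma$ of topological automorphisms of a topological group $G$ acts distally on $G$ if, for every $x\in G\setminus\{e\}$, the identity $e$ is not in the closure of the orbit $\{\gamma(x):\gamma\in\Gamma\}$. The group $G$ is called distal if the group $\operatorname{Inn}(G)$ of inner automorphisms acts distally on $G$. An element $g\in G$ is called distal if the cyclic group generated by the inner automorphism $x\mapsto gxg^{-1}$ acts distally on $G$. The group $G$ is a SIN group if the neighbourhoods of $e$ that are invariant under all inner automorphisms form a neighbourhood base at $e$. A locally compact group $G$ is a generalized $\overline{FC}$-group if it has a finite series $G=G_0\supseteq G_1\supseteq\dots\supseteq G_n=\{e\}$ of closed normal subgroups of $G$ such that, for each $i=0,\dots,n-1$, the topological group $G_i/G_{i+1}$ is compactly generated and each of its conjugacy classes has compact closure. Theorem 2.9. Let $G$ be a totally disconnected generalized $\overline{FC}$-group (not necessarily metrizable). Then the following conditions are equivalent: (i) $G$ is distal; (ii) every $g\in G$ is distal; (iii) $G$ is a SIN group. -/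

import Mathlib

open scoped Topology

/-- A group `Γ` of automorphisms of `G` is distal (acts distally on `G`) if for every `x ≠ 1`
the identity is not in the closure of the orbit `{γ x | γ ∈ Γ}`.  It is applied below to groups of
inner automorphisms, which are homeomorphisms of the topological group `G`. -/
def ActsDistally {G : Type*} [Group G] [TopologicalSpace G] (Γ : Subgroup (MulAut G)) : Prop :=
  ∀ x : G, x ≠ 1 → (1 : G) ∉ closure {y : G | ∃ γ ∈ Γ, γ x = y}

/-- A group `Γ` of automorphisms of `G` is equicontinuous (at the identity) if the
neighbourhoods of the identity that are invariant under `Γ` form a neighbourhood base there. -/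
def ActsEquicontinuously {G : Type*} [Group G] [TopologicalSpace G]
    (Γ : Subgroup (MulAut G)) : Prop :=
  ∀ U ∈ 𝓝 (1 : G), ∃ V ∈ 𝓝 (1 : G), V ⊆ U ∧ ∀ γ ∈ Γ, (fun x => γ x) '' V = V

/-- An automorphism is distal if the cyclic group that it generates acts distally. -/
def IsDistalAut {G : Type*} [Group G] [TopologicalSpace G] (τ : MulAut G) : Prop :=
  ActsDistally (Subgroup.zpowers τ)

/-- The group `Inn(G)` of all inner automorphisms `x ↦ g * x * g⁻¹`. -/
def innerAuts (G : Type*) [Group G] : Subgroup (MulAut G) :=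
  (MulAut.conj : G →* MulAut G).range

/-- `G` is distal if `Inn(G)` acts distally on `G`. -/
def IsDistalGroup (G : Type*) [Group G] [TopologicalSpace G] : Prop :=
  ActsDistally (innerAuts G)

/-- An element `g` is distal if the inner automorphism `x ↦ g * x * g⁻¹` is distal. -/
def IsDistalElement {G : Type*} [Group G] [TopologicalSpace G] (g : G) : Prop :=
  IsDistalAut (MulAut.conj g)

/-- `G` is a SIN group if `Inn(G)` is equicontinuous. -/
def IsSINGroup (G : Type*) [Group G] [TopologicalSpace G] : Prop :=
  ActsEquicontinuously (innerAuts G)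

/-- A topological group is compactly generated if some compact subset generates it (as an
abstract group). -/
def IsCompactlyGeneratedGroup (Q : Type*) [Group Q] [TopologicalSpace Q] : Prop :=
  ∃ K : Set Q, IsCompact K ∧ Subgroup.closure K = ⊤

/-- All conjugacy classes of the topological group are precompact. -/
def HasPrecompactConjClasses (Q : Type*) [Group Q] [TopologicalSpace Q] : Prop :=
  ∀ q : Q, IsCompact (closure (conjugatesOf q))

/-- A generalized `FC`-bar group: a locally compact group with a finite series
`G = H 0 ≥ H 1 ≥ ⋯ ≥ H n = 1` of closed normal subgroups of `G` such that each factor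
`H i / H (i + 1)`, with the quotient topology, is compactly generated and has precompact conjugacy
classes. -/
def IsGeneralizedFCBarGroup (G : Type*) [Group G] [TopologicalSpace G] : Prop :=
  LocallyCompactSpace G ∧
  ∃ (n : ℕ) (H : Fin (n + 1) → Subgroup G) (_ : ∀ i, (H i).Normal),
    H 0 = ⊤ ∧ H (Fin.last n) = ⊥ ∧ (∀ i, IsClosed (H i : Set G)) ∧
    ∀ i : Fin n, H i.succ ≤ H i.castSucc ∧
      IsCompactlyGeneratedGroup (H i.castSucc ⧸ (H i.succ).subgroupOf (H i.castSucc)) ∧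
      HasPrecompactConjClasses (H i.castSucc ⧸ (H i.succ).subgroupOf (H i.castSucc))

/-!
For a set `S` of elements of `G`, let `E(S)` say that conjugation by the elements of `S` is
equicontinuous at the identity (`ConjEquicontinuous`); `G` is a SIN group as soon as `E(G)` holds.
The property `E` passes to subsets and to products `S * T`, and it holds for compact sets. Therefore
the essential implication, from distality of all elements to SIN, follows from two facts.

* If `g` is distal, then `E(⟨g⟩)` (`IsDistalElement.conjEquicontinuous_zpowers`). A distal
  continuous endomorphism of a compact group is surjective (`surjective_of_distal`), so a distal
  automorphism `τ` never maps a compact subgroup properly into itself. For a compact open subgroup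
  `U` this makes `⋂ i ≥ 0, τ⁻ⁱ U` invariant under `τ` and `τ⁻¹`, and then, by compactness, also one
  of the finite intersections, which are open.
* If `Q` is compactly generated with precompact conjugacy classes and `W` is an open subgroup, then
  `Q = ⟨f₁⟩ ⋯ ⟨fₘ⟩ W` for some `f₁, …, fₘ` (`exists_prod_zpowers_mul_eq_univ`). Take a
  conjugation-invariant precompact set `B` that together with `W` generates `Q`, and cover it by
  cosets `fᵢ W` with `fᵢ ∈ B`. Since `B` is invariant, the factors `fᵢ` of a product of elements of
  `B` can be sorted to the front, as in Dietzmann's lemma.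

Lifting the second fact to a factor `M / N` of the series shows that `M` is contained in a product
of finitely many cyclic groups, a compact open subgroup and `N`, so `E(N)` implies `E(M)`
(`ConjEquicontinuous.of_quotient`), and `E(G)` follows by going up the series.
-/

/-! ### Equicontinuous conjugation -/

/-- A set `S` of elements of `G` acts equicontinuously (at the identity) by conjugation. For `S` the
whole group this says that `G` is a SIN group. -/
def ConjEquicontinuous {G : Type*} [Group G] [TopologicalSpace G] (S : Set G) : Prop :=
  ∀ U ∈ 𝓝 (1 : G), {x : G | ∀ s ∈ S, s * x * s⁻¹ ∈ U} ∈ 𝓝 (1 : G)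

namespace ConjEquicontinuous

open Pointwise

variable {G : Type*} [Group G] [TopologicalSpace G] {S T : Set G}

theorem mono (hT : ConjEquicontinuous T) (h : S ⊆ T) : ConjEquicontinuous S := fun U hU =>
  Filter.mem_of_superset (hT U hU) fun _ hx s hs => hx s (h hs)

theorem mul (hS : ConjEquicontinuous S) (hT : ConjEquicontinuous T) :
    ConjEquicontinuous (S * T) := by
  intro U hU
  filter_upwards [hT _ (hS U hU)] with x hx
  rintro _ ⟨s, hs, t, ht, rfl⟩
  simpa [mul_assoc] using hx t ht s hs

theorem one : ConjEquicontinuous (1 : Set G) := by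
  intro U hU
  filter_upwards [hU] with x hx
  simpa using hx

theorem list_prod {l : List (Set G)} (h : ∀ S ∈ l, ConjEquicontinuous S) :
    ConjEquicontinuous l.prod := by
  induction l with
  | nil => exact one
  | cons S l ih =>
    rw [List.prod_cons]
    exact (h S (by simp)).mul (ih fun T hT => h T (by simp [hT]))

theorem of_isCompact [IsTopologicalGroup G] (hS : IsCompact S) : ConjEquicontinuous S := by
  intro U hU
  refine hS.eventually_forall_of_forall_eventually fun s _ => ?_
  have hc : Continuous fun p : G × G => p.2 * p.1 * p.2⁻¹ := by fun_prop
  exact hc.continuousAt.preimage_mem_nhds (by simpa using hU)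

end ConjEquicontinuous

/-! ### Compact open subgroups -/

/-- Van Dantzig's theorem. The subgroup is the stabilizer, under left translation, of a compact
open neighbourhood of the identity. -/
theorem exists_isOpen_isCompact_subgroup_subset {G : Type*} [Group G] [TopologicalSpace G]
    [IsTopologicalGroup G] [T2Space G] [TotallyDisconnectedSpace G] [LocallyCompactSpace G]
    {U : Set G} (hU : U ∈ 𝓝 (1 : G)) :
    ∃ V : Subgroup G, IsOpen (V : Set G) ∧ IsCompact (V : Set G) ∧ (V : Set G) ⊆ U := by
  obtain ⟨C, hC, hCU, hCc⟩ := local_compact_nhds hU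
  obtain ⟨W, hW, h1W, hWC⟩ := loc_compact_Haus_tot_disc_of_zero_dim.mem_nhds_iff.1 hC
  have hWc : IsCompact W := hCc.of_isClosed_subset hW.1 hWC
  let V : Subgroup G :=
    { carrier := {x | (∀ w ∈ W, x * w ∈ W) ∧ ∀ w ∈ W, x⁻¹ * w ∈ W}
      one_mem' := by simp
      mul_mem' := fun {a b} ha hb =>
        ⟨fun w hw => by simpa [mul_assoc] using ha.1 _ (hb.1 w hw),
          fun w hw => by simpa [mul_assoc] using hb.2 _ (ha.2 w hw)⟩
      inv_mem' := fun {a} ha => ⟨ha.2, by simpa using ha.1⟩ }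
  have hVW : (V : Set G) ⊆ W := fun x hx => by simpa using hx.1 1 h1W
  have hVn : (V : Set G) ∈ 𝓝 (1 : G) := by
    have h1 : ∀ᶠ x in 𝓝 (1 : G), ∀ w ∈ W, x * w ∈ W :=
      hWc.eventually_forall_of_forall_eventually fun w hw =>
        (continuous_mul.continuousAt (x := ((1 : G), w))).preimage_mem_nhds
          (hW.2.mem_nhds (by simpa using hw))
    have h2 : ∀ᶠ x in 𝓝 (1 : G), ∀ w ∈ W, x⁻¹ * w ∈ W :=
      (continuous_inv.tendsto' (1 : G) 1 inv_one).eventually h1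
    exact h1.and h2
  have hVo : IsOpen (V : Set G) := V.isOpen_of_mem_nhds hVn
  exact ⟨V, hVo, hWc.of_isClosed_subset (V.isClosed_of_isOpen hVo) hVW,
    hVW.trans (hWC.trans hCU)⟩

/-! ### A single distal automorphism -/

/-- A distal continuous endomorphism of a compact group is surjective. The closure of its positive
powers in the semigroup of self-maps contains an idempotent `u` by the Ellis–Numakura lemma; `u` is
a homomorphism which by distality has trivial kernel, so `u = 1` and every point is recurrent. -/
theorem surjective_of_distal {K : Type*} [Group K] [TopologicalSpace K] [IsTopologicalGroup K]
    [T2Space K] [CompactSpace K] (φ : K →* K) (hφ : Continuous φ)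
    (hd : ∀ x : K, x ≠ 1 → (1 : K) ∉ closure (Set.range fun n : ℕ => φ^[n + 1] x)) :
    Function.Surjective φ := by
  let : TopologicalSpace (Function.End K) := inferInstanceAs (TopologicalSpace (K → K))
  have : T2Space (Function.End K) := inferInstanceAs (T2Space (K → K))
  have : CompactSpace (Function.End K) := inferInstanceAs (CompactSpace (K → K))
  let P : Set (Function.End K) := Set.range fun n : ℕ => (φ^[n + 1] : K → K)
  have hev (x : K) : Continuous fun f : Function.End K => f x := continuous_apply (A := fun _ => K) x
  have hright (r : Function.End K) : Continuous fun f : Function.End K => f * r :=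
    continuous_pi fun x => hev (r x)
  have hPP : ∀ f ∈ P, ∀ g ∈ closure P, f * g ∈ closure P := by
    rintro _ ⟨n, rfl⟩ g hg
    have hc : Continuous fun g : Function.End K => (show Function.End K from φ^[n + 1]) * g :=
      continuous_pi fun x => (hφ.iterate (n + 1)).comp (hev x)
    refine map_mem_closure hc hg ?_
    rintro _ ⟨m, rfl⟩
    refine ⟨n + 1 + m, ?_⟩
    change φ^[n + 1 + m + 1] = φ^[n + 1] ∘ φ^[m + 1]
    rw [← Function.iterate_add, add_assoc]
  obtain ⟨u, hu, huu⟩ := exists_idempotent_in_compact_subsemigroup hright (closure P)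
    ⟨_, subset_closure ⟨0, rfl⟩⟩ isClosed_closure.isCompact
    (fun f hf g hg => closure_minimal (t := (· * g) ⁻¹' closure P) (fun f hf => hPP f hf g hg)
      (isClosed_closure.preimage (hright g)) hf)
  have hmul (x y : K) : u (x * y) = u x * u y := by
    refine closure_minimal (t := {f : Function.End K | f (x * y) = f x * f y}) ?_
      (isClosed_eq (hev _) ((hev x).mul (hev y))) hu
    rintro _ ⟨n, rfl⟩
    exact iterate_map_mul φ (n + 1) x y
  have horb (x : K) : u x ∈ closure (Set.range fun n : ℕ => φ^[n + 1] x) := by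
    refine map_mem_closure (f := fun f : Function.End K => f x) (hev x) hu ?_
    rintro _ ⟨n, rfl⟩
    exact ⟨n, rfl⟩
  have hidem (x : K) : u (u x) = u x := congrFun huu x
  have hfix (x : K) : u x = x := by
    by_contra hne
    refine hd (u x * x⁻¹) (fun h => hne (mul_inv_eq_one.1 h)) ?_
    have h1 : u (u x * x⁻¹) = 1 := by
      have h : u (u x * x⁻¹) * u x = u (u x) := by rw [← hmul]; simp
      rw [hidem] at h
      exact mul_eq_right.1 h
    exact h1 ▸ horb _
  intro x
  have hx : x ∈ closure (Set.range fun n : ℕ => φ^[n + 1] x) := by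
    simpa only [hfix] using horb x
  refine closure_minimal (t := Set.range φ) ?_ (isCompact_range hφ).isClosed hx
  rintro _ ⟨n, rfl⟩
  exact ⟨φ^[n] x, (Function.iterate_succ_apply' φ n x).symm⟩

/-- A distal automorphism cannot map a compact subgroup into a proper subgroup of itself. -/
theorem IsDistalAut.mem_of_apply_mem {G : Type*} [Group G] [TopologicalSpace G]
    [IsTopologicalGroup G] [T2Space G] {τ : MulAut G} (hτ : IsDistalAut τ) (hc : Continuous τ)
    {K : Subgroup G} (hK : IsCompact (K : Set G)) (h : ∀ x ∈ K, τ x ∈ K) {x : G} (hx : τ x ∈ K) :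
    x ∈ K := by
  have : CompactSpace K := isCompact_iff_compactSpace.1 hK
  let φ : K →* K := (τ.toMonoidHom.comp K.subtype).codRestrict K fun y => h y y.2
  have hφ : Continuous φ := (hc.comp continuous_subtype_val).subtype_mk _
  have hiter (n : ℕ) (y : K) : ((φ^[n] y : K) : G) = (τ ^ n) (y : G) := by
    induction n with
    | zero => rfl
    | succ n ih =>
      rw [Function.iterate_succ_apply', pow_succ', MulAut.mul_apply, ← ih]
      rfl
  obtain ⟨y, hy⟩ := surjective_of_distal φ hφ (fun y hy hmem => hτ y (by simpa using hy) <| by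
    refine map_mem_closure (f := ((↑) : K → G)) continuous_subtype_val hmem ?_
    rintro _ ⟨n, rfl⟩
    exact ⟨τ ^ (n + 1), Subgroup.npow_mem_zpowers τ (n + 1), (hiter (n + 1) y).symm⟩) ⟨τ x, hx⟩
  have hyx : (y : G) = x := τ.injective (congrArg Subtype.val hy)
  exact hyx ▸ y.2

theorem IsDistalAut.inv {G : Type*} [Group G] [TopologicalSpace G] {τ : MulAut G}
    (hτ : IsDistalAut τ) : IsDistalAut τ⁻¹ := by
  rwa [IsDistalAut, Subgroup.zpowers_inv]

/-- A distal automorphism `τ` acts equicontinuously. By compactness, `⋂ i ≤ n, τ⁻ⁱ U` is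
`τ⁻¹`-invariant for some `n`, since `⋂ i, τ⁻ⁱ U` is `τ`-invariant and so equal to its image. -/
theorem IsDistalAut.forall_zpow_mem {G : Type*} [Group G] [TopologicalSpace G]
    [IsTopologicalGroup G] [T2Space G] {τ : MulAut G} (hτ : IsDistalAut τ) (hc : Continuous τ)
    (hc' : Continuous τ.symm) {U : Subgroup G} (hU : IsOpen (U : Set G))
    (hUc : IsCompact (U : Set G)) :
    {x : G | ∀ n : ℤ, (τ ^ n) x ∈ U} ∈ 𝓝 (1 : G) := by
  have hcont (i : ℕ) : Continuous (τ ^ i : MulAut G) := by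
    induction i with
    | zero => exact continuous_id
    | succ i ih => rw [pow_succ']; exact hc.comp ih
  let V (n : ℕ) : Subgroup G := ⨅ i ∈ Set.Iic n, U.comap (τ ^ i : MulAut G).toMonoidHom
  let P : Subgroup G := ⨅ i : ℕ, U.comap (τ ^ i : MulAut G).toMonoidHom
  have memV {n : ℕ} {x : G} : x ∈ V n ↔ ∀ i ≤ n, (τ ^ i) x ∈ U := by
    simp [V, Subgroup.mem_iInf]
  have memP {x : G} : x ∈ P ↔ ∀ i : ℕ, (τ ^ i) x ∈ U := by
    simp [P, Subgroup.mem_iInf]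
  have hUcl : IsClosed (U : Set G) := U.isClosed_of_isOpen hU
  have hVset (n : ℕ) : (V n : Set G) = ⋂ i ∈ Set.Iic n, (τ ^ i) ⁻¹' (U : Set G) := by
    ext x; simpa using memV
  have hVo (n : ℕ) : IsOpen (V n : Set G) := by
    rw [hVset]
    exact (Set.finite_Iic n).isOpen_biInter fun i _ => hU.preimage (hcont i)
  have hVcl (n : ℕ) : IsClosed (V n : Set G) := (V n).isClosed_of_isOpen (hVo n)
  have hVc (n : ℕ) : IsCompact (V n : Set G) :=
    hUc.of_isClosed_subset (hVcl n) fun x hx => memV.1 hx 0 (Nat.zero_le n)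
  have hPV : (P : Set G) = ⋂ n, (V n : Set G) := by
    ext x
    simp only [Set.mem_iInter, SetLike.mem_coe, memP, memV]
    exact ⟨fun h n i _ => h i, fun h i => h i i le_rfl⟩
  have hPc : IsCompact (P : Set G) :=
    hUc.of_isClosed_subset (hPV ▸ isClosed_iInter hVcl) fun x hx => memP.1 hx 0
  have hPinv : ∀ x ∈ P, τ x ∈ P := fun x hx =>
    memP.2 fun i => by simpa [pow_succ] using memP.1 hx (i + 1)
  have hPsymm : ∀ x ∈ P, τ.symm x ∈ U := fun x hx =>
    memP.1 (hτ.mem_of_apply_mem hc hPc hPinv (x := τ.symm x) (by simpa using hx)) 0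
  obtain ⟨n, hn⟩ : ∃ n, (V n : Set G) ⊆ τ.symm ⁻¹' (U : Set G) := by
    refine exists_subset_nhds_of_isCompact (directed_of_isDirected_le ?_) hVc fun x hx =>
      (hU.preimage hc').mem_nhds (hPsymm x (by rw [← hPV] at hx; exact hx))
    exact fun m n hmn x hx => memV.2 fun i hi => memV.1 hx i (hi.trans hmn)
  have hVinv : ∀ x ∈ V n, τ⁻¹ x ∈ V n := fun x hx => memV.2 fun i hi => by
    cases i with
    | zero => exact hn hx
    | succ i =>
      rw [pow_succ, MulAut.mul_apply, MulAut.apply_inv_self]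
      exact memV.1 hx i (by omega)
  have hVinv' : ∀ x ∈ V n, τ x ∈ V n := fun x hx =>
    hτ.inv.mem_of_apply_mem hc' (hVc n) hVinv (by simpa using hx)
  filter_upwards [(hVo n).mem_nhds (V n).one_mem] with x hx m
  have hm : ∀ y ∈ V n, (τ ^ m) y ∈ V n := by
    induction m with
    | zero => exact fun y hy => hy
    | succ m ih => intro y hy; rw [zpow_add_one]; exact ih _ (hVinv' y hy)
    | pred m ih => intro y hy; rw [zpow_sub_one]; exact ih _ (hVinv y hy)
  exact memV.1 (hm x hx) 0 (Nat.zero_le n)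

theorem IsDistalElement.conjEquicontinuous_zpowers {G : Type*} [Group G] [TopologicalSpace G]
    [IsTopologicalGroup G] [T2Space G] [TotallyDisconnectedSpace G] [LocallyCompactSpace G]
    {g : G} (hg : IsDistalElement g) : ConjEquicontinuous (Subgroup.zpowers g : Set G) := by
  intro U hU
  obtain ⟨V, hVo, hVc, hVU⟩ := exists_isOpen_isCompact_subgroup_subset hU
  have hc : Continuous (MulAut.conj g) := by
    change Continuous fun x => g * x * g⁻¹
    fun_prop
  have hc' : Continuous (MulAut.conj g).symm := by
    change Continuous fun x => g⁻¹ * x * g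
    fun_prop
  filter_upwards [IsDistalAut.forall_zpow_mem hg hc hc' hVo hVc] with x hx
  rintro _ ⟨n, rfl⟩
  have h := hx n
  rw [← map_zpow] at h
  exact hVU h

/-! ### Bounded generation by cyclic subgroups -/

section BoundedGeneration

open Pointwise

variable {Q : Type*} [Group Q]

/-- Let `W` be a subgroup and `B` a conjugation-invariant set covered by the cosets `f W`, for `f`
in a subset `F` of `B`. Factors from a list `l` of elements of `F` can be sorted to the front of a
product of `k` elements of `B` and an element of `W`, unless a factor outside `l` can be moved
there; when `l` exhausts `F` the second alternative is void. -/
theorem mem_prod_zpowers_mul_or {B F : Set Q} {W : Subgroup Q}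
    (hB : ∀ q : Q, ∀ b ∈ B, q * b * q⁻¹ ∈ B) (hFB : F ⊆ B) (hBF : B ⊆ F * (W : Set Q))
    (l : List Q) (k : ℕ) {y : Q} (hy : y ∈ B ^ k * (W : Set Q)) :
    y ∈ (l.map fun f => (Subgroup.zpowers f : Set Q)).prod * (W : Set Q) ∨
      ∃ f ∈ F, f ∉ l ∧ ∃ m, m < k ∧ f⁻¹ * y ∈ B ^ m * (W : Set Q) := by
  have hstep {m : ℕ} {b z : Q} (hb : b ∈ B) (hz : z ∈ B ^ m * (W : Set Q)) :
      b * z ∈ B ^ (m + 1) * (W : Set Q) := by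
    rw [pow_succ', mul_assoc]
    exact Set.mul_mem_mul hb hz
  have hW {w : Q} (hw : w ∈ W) (m : ℕ) :
      ∀ z ∈ B ^ m * (W : Set Q), w * z ∈ B ^ m * (W : Set Q) := by
    induction m with
    | zero => simpa using fun z hz => W.mul_mem hw hz
    | succ m ih =>
      intro z hz
      rw [pow_succ', mul_assoc] at hz
      obtain ⟨b, hb, x, hx, rfl⟩ := hz
      simpa [mul_assoc] using hstep (hB w b hb) (ih x hx)
  induction l generalizing k y with
  | nil =>
    cases k with
    | zero => left; simpa using hy
    | succ k =>
      right
      rw [pow_succ', mul_assoc] at hy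
      obtain ⟨b, hb, x, hx, rfl⟩ := hy
      obtain ⟨f, hf, w, hw, rfl⟩ := hBF hb
      exact ⟨f, hf, by simp, k, k.lt_succ_self, by simpa [mul_assoc] using hW hw k x hx⟩
  | cons f l ihl =>
    induction k using Nat.strong_induction_on generalizing y with
    | _ k ihk =>
    rw [List.map_cons, List.prod_cons, mul_assoc]
    rcases ihl k hy with h | ⟨f', hf', hl, m, hm, hz⟩
    · left
      exact ⟨1, one_mem _, y, h, one_mul y⟩
    by_cases hff : f' = f
    · subst hff
      rcases ihk m hm hz with h | ⟨g, hg, hgl, p, hp, hu⟩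
      · left
        rw [List.map_cons, List.prod_cons, mul_assoc] at h
        obtain ⟨a, ha, s, hs, has⟩ := h
        exact ⟨f' * a, mul_mem (Subgroup.mem_zpowers f') ha, s, hs, by
          simp only at has ⊢; rw [mul_assoc, has, mul_inv_cancel_left]⟩
      · right
        refine ⟨g, hg, hgl, p + 1, by omega, ?_⟩
        -- `f' * g = g * (g⁻¹ * f' * g)`, so `g` can be moved in front of `f'`.
        have h := hstep (hB g⁻¹ f' (hFB hf')) hu
        simpa [mul_assoc] using h
    · right
      exact ⟨f', hf', by simp [hff, hl], m, hm, hz⟩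

variable [TopologicalSpace Q] [IsTopologicalGroup Q]

/-- A compactly generated group with precompact conjugacy classes is boundedly generated by finitely
many cyclic subgroups and any given open subgroup. -/
theorem exists_prod_zpowers_mul_eq_univ (hcg : IsCompactlyGeneratedGroup Q)
    (hcl : HasPrecompactConjClasses Q) {W : Subgroup Q} (hW : IsOpen (W : Set Q)) :
    ∃ l : List Q,
      (l.map fun f => (Subgroup.zpowers f : Set Q)).prod * (W : Set Q) = Set.univ := by
  have hcosets {C : Set Q} (hC : IsCompact (closure C)) :
      ∃ F : Set Q, F.Finite ∧ F ⊆ C ∧ C ⊆ F * (W : Set Q) := by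
    obtain ⟨t, htC, htf, ht⟩ := hC.elim_finite_subcover_image (b := C)
      (c := fun x => x • (W : Set Q)) (fun x _ => hW.smul x) (by
        intro x hx
        -- The open neighbourhood `x W` of `x` meets `C`.
        obtain ⟨y, ⟨w, hw, rfl⟩, hyC⟩ := mem_closure_iff.1 hx _ (hW.smul x)
          ⟨1, W.one_mem, by simp⟩
        refine Set.mem_biUnion hyC ⟨w⁻¹, W.inv_mem hw, by simp⟩)
    refine ⟨t, htf, htC, fun x hx => ?_⟩
    obtain ⟨f, hf, w, hw, rfl⟩ := Set.mem_iUnion₂.1 (ht (subset_closure hx))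
    exact Set.mul_mem_mul hf hw
  obtain ⟨K, hK, hKtop⟩ := hcg
  obtain ⟨E, hE, -, hKE⟩ := hcosets hK.closure
  set B : Set Q := ⋃ e ∈ E ∪ E⁻¹, conjugatesOf e with hBdef
  have hBc : IsCompact (closure B) := by
    rw [hBdef, (hE.union hE.inv).closure_biUnion]
    exact (hE.union hE.inv).isCompact_biUnion fun e _ => hcl e
  have hB : ∀ q : Q, ∀ b ∈ B, q * b * q⁻¹ ∈ B := by
    intro q b hb
    obtain ⟨e, he, hb⟩ := Set.mem_iUnion₂.1 hb
    refine Set.mem_iUnion₂.2 ⟨e, he, ?_⟩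
    exact IsConj.trans hb (isConj_iff.2 ⟨q, rfl⟩)
  have hEB : E ∪ E⁻¹ ⊆ B := fun e he => Set.mem_iUnion₂.2 ⟨e, he, mem_conjugatesOf_self⟩
  obtain ⟨F, hF, hFB, hBF⟩ := hcosets hBc
  have hgen (x : Q) : ∃ k, x ∈ B ^ k * (W : Set Q) := by
    have hmulB {b z : Q} (hb : b ∈ B) (hz : ∃ k, z ∈ B ^ k * (W : Set Q)) :
        ∃ k, b * z ∈ B ^ k * (W : Set Q) := by
      obtain ⟨k, hz⟩ := hz
      refine ⟨k + 1, ?_⟩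
      rw [pow_succ', mul_assoc]
      exact Set.mul_mem_mul hb hz
    have hmulW {w z : Q} (hw : w ∈ W) (hz : ∃ k, z ∈ B ^ k * (W : Set Q)) :
        ∃ k, w * z ∈ B ^ k * (W : Set Q) := by
      obtain ⟨k, hz⟩ := hz
      induction k generalizing z with
      | zero => exact ⟨0, by simpa using W.mul_mem hw (by simpa using hz)⟩
      | succ k ih =>
        rw [pow_succ', mul_assoc] at hz
        obtain ⟨b, hb, x, hx, rfl⟩ := hz
        simpa [mul_assoc] using hmulB (hB w b hb) (ih hx)
    have hx : x ∈ Subgroup.closure K := hKtop ▸ Subgroup.mem_top x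
    induction hx using Subgroup.closure_induction_left with
    | one => exact ⟨0, by simp⟩
    | mul_left y hy z _ ih =>
      obtain ⟨e, he, w, hw, rfl⟩ := hKE hy
      simpa [mul_assoc] using hmulB (hEB (Or.inl he)) (hmulW hw ih)
    | inv_mul_cancel y hy z _ ih =>
      obtain ⟨e, he, w, hw, rfl⟩ := hKE hy
      simpa [mul_assoc] using
        hmulW (W.inv_mem hw) (hmulB (hEB (Or.inr (Set.inv_mem_inv.2 he))) ih)
  refine ⟨hF.toFinset.toList, Set.eq_univ_of_forall fun x => ?_⟩
  obtain ⟨k, hk⟩ := hgen x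
  rcases mem_prod_zpowers_mul_or hB hFB hBF hF.toFinset.toList k hk with h | ⟨f, hf, hfl, -⟩
  · exact h
  · exact absurd (by simpa using hf) hfl

end BoundedGeneration

/-! ### Climbing the series -/

open Pointwise in
/-- Equicontinuity passes from `N` to `M` when `M / N` is compactly generated with precompact
conjugacy classes: `M` is contained in the product of finitely many cyclic groups, a compact open
subgroup and `N`. -/
theorem ConjEquicontinuous.of_quotient {G : Type*} [Group G] [TopologicalSpace G]
    [IsTopologicalGroup G] [T2Space G] [TotallyDisconnectedSpace G] [LocallyCompactSpace G]
    (hd : ∀ g : G, IsDistalElement g) {M N : Subgroup G} [N.Normal]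
    (hcg : IsCompactlyGeneratedGroup (M ⧸ N.subgroupOf M))
    (hcl : HasPrecompactConjClasses (M ⧸ N.subgroupOf M))
    (hN : ConjEquicontinuous (N : Set G)) : ConjEquicontinuous (M : Set G) := by
  obtain ⟨V, hVo, hVc, -⟩ := exists_isOpen_isCompact_subgroup_subset (G := G) Filter.univ_mem
  let π : M →* M ⧸ N.subgroupOf M := QuotientGroup.mk' _
  let W : Subgroup (M ⧸ N.subgroupOf M) := (V.subgroupOf M).map π
  have hW : IsOpen (W : Set (M ⧸ N.subgroupOf M)) :=
    QuotientGroup.isOpenMap_coe _ (hVo.preimage continuous_subtype_val)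
  obtain ⟨l, hl⟩ := exists_prod_zpowers_mul_eq_univ hcg hcl hW
  -- Lifts to `G` of the elements of `l`.
  let L : List G := l.map fun f => ((Quotient.out f : M) : G)
  have hlift (l : List (M ⧸ N.subgroupOf M)) (q : M ⧸ N.subgroupOf M)
      (hq : q ∈ (l.map fun f => (Subgroup.zpowers f : Set (M ⧸ N.subgroupOf M))).prod) :
      ∃ x : M, π x = q ∧ (x : G) ∈ ((l.map fun f => ((Quotient.out f : M) : G)).map
        fun g => (Subgroup.zpowers g : Set G)).prod := by
    induction l generalizing q with
    | nil => exact ⟨1, by simpa using hq.symm, by simp⟩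
    | cons f l ih =>
      simp only [List.map_cons, List.prod_cons] at hq ⊢
      obtain ⟨_, ⟨n, rfl⟩, q, hq, rfl⟩ := hq
      obtain ⟨x, rfl, hx⟩ := ih q hq
      refine ⟨(Quotient.out f : M) ^ n * x, ?_, Set.mul_mem_mul ⟨n, by simp⟩ hx⟩
      rw [map_mul, map_zpow]
      congr 2
      exact Quotient.out_eq' f
  have hprod : ConjEquicontinuous (L.map fun g => (Subgroup.zpowers g : Set G)).prod :=
    ConjEquicontinuous.list_prod fun S hS => by
      obtain ⟨g, -, rfl⟩ := List.mem_map.1 hS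
      exact (hd g).conjEquicontinuous_zpowers
  refine ((hprod.mul (ConjEquicontinuous.of_isCompact hVc)).mul hN).mono fun x hx => ?_
  have hxl : π ⟨x, hx⟩ ∈ (Set.univ : Set (M ⧸ N.subgroupOf M)) := Set.mem_univ _
  rw [← hl] at hxl
  obtain ⟨q, hq, _, ⟨v, hv, rfl⟩, hqv⟩ := hxl
  obtain ⟨y, rfl, hy⟩ := hlift l q hq
  have hn : (y * v)⁻¹ * ⟨x, hx⟩ ∈ N.subgroupOf M :=
    QuotientGroup.eq.1 (by simpa using! hqv)
  exact ⟨y * v, Set.mul_mem_mul hy hv, _, hn, by simp [mul_assoc]⟩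

/-! ### The equivalence -/

theorem IsDistalGroup.isDistalElement {G : Type*} [Group G] [TopologicalSpace G]
    (h : IsDistalGroup G) (g : G) : IsDistalElement g := fun x hx hmem =>
  h x hx <| closure_mono (by
    rintro y ⟨γ, ⟨n, rfl⟩, hy⟩
    exact ⟨_, ⟨g ^ n, map_zpow MulAut.conj g n⟩, hy⟩) hmem

theorem IsSINGroup.isDistalGroup {G : Type*} [Group G] [TopologicalSpace G] [T1Space G]
    (h : IsSINGroup G) : IsDistalGroup G := by
  intro x hx hmem
  obtain ⟨V, hV, hVx, hinv⟩ := h {x}ᶜ (isOpen_compl_singleton.mem_nhds hx.symm)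
  obtain ⟨y, hyV, γ, hγ, rfl⟩ := mem_closure_iff_nhds.1 hmem V hV
  -- `V` is invariant and contains `γ x`, so it contains `x`.
  rw [← hinv γ hγ] at hyV
  obtain ⟨z, hz, hzx⟩ := hyV
  exact hVx hz (γ.injective hzx)

theorem ConjEquicontinuous.isSINGroup {G : Type*} [Group G] [TopologicalSpace G]
    (h : ConjEquicontinuous (Set.univ : Set G)) : IsSINGroup G := by
  intro U hU
  refine ⟨_, h U hU, fun x hx => by simpa using hx 1 trivial, ?_⟩
  have hsub (g : G) {x : G} (hx : ∀ s ∈ (Set.univ : Set G), s * x * s⁻¹ ∈ U) :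
      ∀ s ∈ (Set.univ : Set G), s * (g * x * g⁻¹) * s⁻¹ ∈ U := fun s _ => by
    simpa [mul_assoc] using hx (s * g) trivial
  rintro _ ⟨g, rfl⟩
  refine Set.Subset.antisymm ?_ fun x hx => ?_
  · rintro _ ⟨x, hx, rfl⟩
    exact hsub g hx
  · exact ⟨g⁻¹ * x * g, by simpa using! hsub g⁻¹ hx, by simp [mul_assoc]⟩

theorem IsGeneralizedFCBarGroup.conjEquicontinuous_univ {G : Type*} [Group G] [TopologicalSpace G]
    [IsTopologicalGroup G] [T2Space G] [TotallyDisconnectedSpace G]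
    (hG : IsGeneralizedFCBarGroup G) (hd : ∀ g : G, IsDistalElement g) :
    ConjEquicontinuous (Set.univ : Set G) := by
  obtain ⟨hlc, n, H, hnormal, htop, hbot, -, hfactor⟩ := hG
  have key (i : Fin (n + 1)) : ConjEquicontinuous (H i : Set G) := by
    induction i using Fin.reverseInduction with
    | last =>
      rw [hbot, Subgroup.coe_bot]
      exact ConjEquicontinuous.one
    | cast i ih =>
      have := hnormal i.succ
      exact ConjEquicontinuous.of_quotient hd (hfactor i).2.1 (hfactor i).2.2 ih
  simpa [htop] using key 0

theorem theorem2p9 (G : Type*) [Group G] [TopologicalSpace G] [IsTopologicalGroup G] [T2Space G]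
    [TotallyDisconnectedSpace G] (hG : IsGeneralizedFCBarGroup G) :
    [IsDistalGroup G, ∀ g : G, IsDistalElement g, IsSINGroup G].TFAE := by
  tfae_have 1 → 2 := IsDistalGroup.isDistalElement
  tfae_have 2 → 3 := fun hd => (hG.conjEquicontinuous_univ hd).isSINGroup
  tfae_have 3 → 1 := IsSINGroup.isDistalGroup
  tfae_finish
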